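/- For complex numbers $a,q$ and an integer $m\ge 0$ write $(a;q)_m=\prod_{j=0}^{m-1}(1-aq^j)$, and for $|q|<1$ write $(a;q)_\infty=\prod_{j=0}^{\infty}(1-aq^j)$ and $(a,b,c;q)_\infty=(a;q)_\infty(b;q)_\infty(c;q)_\infty$. Let $q$ be a complex number with $|q|<1$. Then $$\sum_{n,r\ge 0}\frac{q^{n^2+3r^2+4nr}\,(-q;q^2)_{n+r}\,(q^2;q^2)_{n+r}}{(q^2;q^2)_{2n+2r}\,(q^2;q^2)_r\,(q^2;q^2)_n} =\sum_{n,r\ge 0}\frac{q^{n^2+3r^2+4nr}\,(-q;-q)_{2n+2r}}{(q^2;q^2)_{2n+2r}\,(q^2;q^2)_r\,(q^2;q^2)_n} =\frac{(q^6,q^8,q^{14};q^{14})_\infty\,(q^2;q^4)_\infty}{(q;q)_\infty} =\frac{(q^6,q^8,q^{14};q^{14})_\infty\,(-q;q^2)_\infty}{(q^2;q^2)_\infty},$$ where both double series converge absolutely. -/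

import Mathlib

/-- The finite rising `q`-factorial `(a; q)_m = ∏_{j=0}^{m-1} (1 - a q^j)`. -/
def qPoch (a q : ℂ) (m : ℕ) : ℂ :=
  ∏ j ∈ Finset.range m, (1 - a * q ^ j)

/-- The infinite rising `q`-factorial `(a; q)_∞ = ∏_{j=0}^∞ (1 - a q^j)`, meaningful for `‖q‖ < 1`
(see `multipliable_qPochInf`). -/
noncomputable def qPochInf (a q : ℂ) : ℂ :=
  ∏' j : ℕ, (1 - a * q ^ j)

/-- The infinite product defining `(a; q)_∞` converges for `‖q‖ < 1`. -/
theorem multipliable_qPochInf (a : ℂ) {q : ℂ} (hq : ‖q‖ < 1) :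
    Multipliable fun j : ℕ => 1 - a * q ^ j := by
  have h : Summable fun j : ℕ => -(a * q ^ j) :=
    ((summable_geometric_of_norm_lt_one hq).mul_left a).neg
  simpa [sub_eq_add_neg] using Complex.multipliable_one_add_of_summable h

/-- The finite product `(a; q)_m` tends to `(a; q)_∞` as `m → ∞`, for `‖q‖ < 1`. -/
theorem tendsto_qPoch (a : ℂ) {q : ℂ} (hq : ‖q‖ < 1) :
    Filter.Tendsto (qPoch a q) Filter.atTop (nhds (qPochInf a q)) :=
  (multipliable_qPochInf a hq).hasProd.tendsto_prod_nat

/-- `(a, b, c; q)_∞ = (a; q)_∞ (b; q)_∞ (c; q)_∞`. -/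
noncomputable def qPochInf₃ (a b c q : ℂ) : ℂ :=
  qPochInf a q * qPochInf b q * qPochInf c q

/-! Put Q = q² and N = n + r. The exponent is N² + 2rN, so collecting terms with fixed N leaves the
weight (-q;q²)_N q^{N²} times (Q)_N/(Q)_{2N} times Σ_r Q^{rN}/((Q)_r (Q)_{N-r}). Bressoud's finite
identity (`qPoch_mul_qConv_pent`) turns the last two factors into Σ_j (-1)^j q^{3j²-j}/((Q)_{N+2j}
(Q)_{N-2j}): a Bailey pair supported on even indices.

The sum over N can then be done first. By a conjugate Bailey pair (`baileySum_eq`), summing the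
weight against 1/((Q)_{N+k} (Q)_{N-k}) gives q^{k²} (-q;q²)_∞/(Q)_∞. Taking k = 2j leaves the theta
series Σ_j (-1)^j q^{7j²-j}, which the Jacobi triple product (`tsum_thetaTerm`) factors in base
q^14. The remaining equalities are parity dissections of q-factorials.

Both finite identities (Bressoud and the finite triple product) follow from q-Pascal rules for one
kind of bilateral sum, `qConv`. The case q = 0 is separate, because negative powers of q occur
throughout. -/

open Filter Topology Finset

/-! ### q-factorials: recursion and nonvanishing -/

theorem qPoch_zero (a q : ℂ) : qPoch a q 0 = 1 := by simp [qPoch]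

theorem qPoch_succ (a q : ℂ) (m : ℕ) : qPoch a q (m + 1) = qPoch a q m * (1 - a * q ^ m) := by
  simp [qPoch, Finset.prod_range_succ]

theorem one_sub_pow_succ_ne_zero {Q : ℂ} (hQ : ‖Q‖ < 1) (n : ℕ) : 1 - Q ^ (n + 1) ≠ 0 := by
  intro h
  have h1 : ‖Q ^ (n + 1)‖ < 1 := by
    rw [norm_pow]; exact pow_lt_one₀ (norm_nonneg _) hQ (by omega)
  rw [← sub_eq_zero.mp h] at h1
  simp at h1

theorem qPoch_self_ne_zero {Q : ℂ} (hQ : ‖Q‖ < 1) (m : ℕ) : qPoch Q Q m ≠ 0 := by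
  refine Finset.prod_ne_zero_iff.mpr fun j _ => ?_
  rw [← pow_succ']
  exact one_sub_pow_succ_ne_zero hQ j

theorem qPochInf_ne_zero {a q : ℂ} (hq : ‖q‖ < 1) (h : ∀ j : ℕ, 1 - a * q ^ j ≠ 0) :
    qPochInf a q ≠ 0 := by
  have hs : Summable fun j : ℕ => ‖-(a * q ^ j)‖ :=
    (((summable_geometric_of_norm_lt_one hq).mul_left a).neg).norm
  simpa [qPochInf, sub_eq_add_neg] using
    tprod_one_add_ne_zero_of_summable (f := fun j : ℕ => -(a * q ^ j))
      (fun j => by simpa [sub_eq_add_neg] using h j) hs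

theorem qPochInf_self_ne_zero {Q : ℂ} (hQ : ‖Q‖ < 1) : qPochInf Q Q ≠ 0 :=
  qPochInf_ne_zero hQ fun j => by
    rw [← pow_succ']
    exact one_sub_pow_succ_ne_zero hQ j

theorem exists_norm_le_of_tendsto {u : ℕ → ℂ} {l : ℂ} (h : Tendsto u atTop (𝓝 l)) :
    ∃ C : ℝ, ∀ n, ‖u n‖ ≤ C := by
  obtain ⟨C, hC⟩ := h.norm.bddAbove_range
  exact ⟨C, fun n => hC ⟨n, rfl⟩⟩

/-! ### Reciprocal q-factorials on all integers -/

/-- The reciprocal `1 / (Q; Q)_k`, extended by zero to negative integers `k`. -/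
noncomputable def qRecip (Q : ℂ) (k : ℤ) : ℂ :=
  if k < 0 then 0 else (qPoch Q Q k.toNat)⁻¹

theorem qRecip_of_neg (Q : ℂ) {k : ℤ} (hk : k < 0) : qRecip Q k = 0 := by simp [qRecip, hk]

theorem qRecip_natCast (Q : ℂ) (k : ℕ) : qRecip Q k = (qPoch Q Q k)⁻¹ := by simp [qRecip]

theorem qRecip_zero (Q : ℂ) : qRecip Q 0 = 1 := by simp [qRecip, qPoch_zero]

/-- The extension by zero makes this recursion valid without boundary cases: at k = 0 the factor 1 -
Q^0 vanishes. -/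
theorem qRecip_sub_one {Q : ℂ} (hQ : ‖Q‖ < 1) (k : ℤ) :
    qRecip Q (k - 1) = (1 - Q ^ k) * qRecip Q k := by
  rcases lt_trichotomy k 0 with hk | rfl | hk
  · rw [qRecip_of_neg Q hk, qRecip_of_neg Q (by omega), mul_zero]
  · simp [qRecip]
  · obtain ⟨n, rfl⟩ : ∃ n : ℕ, k = n + 1 := ⟨(k - 1).toNat, by omega⟩
    have h := one_sub_pow_succ_ne_zero hQ n
    have h2 := qPoch_self_ne_zero hQ n
    have e : ((n : ℤ) + 1) = ((n + 1 : ℕ) : ℤ) := by push_cast; rfl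
    rw [add_sub_cancel_right, e, qRecip_natCast, qRecip_natCast, qPoch_succ, zpow_natCast,
      ← pow_succ']
    field_simp

theorem tendsto_qRecip {Q : ℂ} (hQ : ‖Q‖ < 1) :
    Tendsto (fun n : ℕ => qRecip Q n) atTop (𝓝 (qPochInf Q Q)⁻¹) := by
  simp only [qRecip_natCast]
  exact (tendsto_qPoch Q hQ).inv₀ (qPochInf_self_ne_zero hQ)

theorem tendsto_qRecip_comp {Q : ℂ} (hQ : ‖Q‖ < 1) {u : ℕ → ℤ} (hu : Tendsto u atTop atTop) :
    Tendsto (fun n => qRecip Q (u n)) atTop (𝓝 (qPochInf Q Q)⁻¹) := by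
  have h1 : Tendsto (fun n => (u n).toNat) atTop atTop :=
    tendsto_atTop.mpr fun b => by
      filter_upwards [hu.eventually_ge_atTop (b : ℤ)] with n hn
      omega
  refine ((tendsto_qRecip hQ).comp h1).congr' ?_
  filter_upwards [hu.eventually_ge_atTop 0] with n hn
  simp [Int.toNat_of_nonneg hn]

theorem exists_norm_qRecip_le {Q : ℂ} (hQ : ‖Q‖ < 1) : ∃ C : ℝ, 0 ≤ C ∧ ∀ k, ‖qRecip Q k‖ ≤ C := by
  obtain ⟨C, hC⟩ := exists_norm_le_of_tendsto (tendsto_qRecip hQ)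
  have h0 : 0 ≤ C := (norm_nonneg _).trans (hC 0)
  refine ⟨C, h0, fun k => ?_⟩
  rcases lt_or_ge k 0 with hk | hk
  · simpa [qRecip_of_neg Q hk] using h0
  · simpa [Int.toNat_of_nonneg hk] using hC k.toNat

/-! ### Bilateral sums and their q-Pascal rules -/

/-- The sum `∑_j f(j) / ((Q; Q)_{m + d j} (Q; Q)_{n - d j})` over all integers `j`. -/
noncomputable def qConv (Q : ℂ) (d : ℤ) (f : ℤ → ℂ) (m n : ℤ) : ℂ :=
  ∑' j : ℤ, f j * (qRecip Q (m + d * j) * qRecip Q (n - d * j))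

/-- Only finitely many terms are nonzero, since one of the two indices is negative once |j| is
large. -/
theorem summable_qConv (Q : ℂ) {d : ℤ} (hd : 0 < d) (f : ℤ → ℂ) (m n : ℤ) :
    Summable fun j : ℤ => f j * (qRecip Q (m + d * j) * qRecip Q (n - d * j)) := by
  refine summable_of_ne_finset_zero (s := Finset.Icc (-|m|) |n|) fun j hj => ?_
  rw [Finset.mem_Icc, not_and_or, not_le, not_le] at hj
  have h1 := le_abs_self m
  have h2 := le_abs_self n
  have h3 := abs_nonneg m
  have h4 := abs_nonneg n
  rcases hj with hj | hj
  · rw [qRecip_of_neg Q (k := m + d * j) (by nlinarith)]; simp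
  · rw [qRecip_of_neg Q (k := n - d * j) (by nlinarith)]; simp

theorem qConv_shift (Q : ℂ) (d : ℤ) (f : ℤ → ℂ) (m n c : ℤ) :
    qConv Q d f m n = qConv Q d (fun j => f (j + c)) (m + d * c) (n - d * c) := by
  unfold qConv
  rw [← (Equiv.addRight c).tsum_eq]
  refine tsum_congr fun j => ?_
  simp only [Equiv.coe_addRight]
  congr 3 <;> ring

theorem qConv_reflect (Q : ℂ) (d : ℤ) (f : ℤ → ℂ) (m n c : ℤ) :
    qConv Q d f m n = qConv Q d (fun j => f (c - j)) (n - d * c) (m + d * c) := by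
  unfold qConv
  rw [← (Equiv.subLeft c).tsum_eq]
  refine tsum_congr fun j => ?_
  simp only [Equiv.subLeft_apply]
  rw [mul_comm (qRecip Q (n - d * c + d * j))]
  congr 3 <;> ring

theorem qConv_const_mul (Q : ℂ) (d : ℤ) (c : ℂ) (f : ℤ → ℂ) (m n : ℤ) :
    qConv Q d (fun j => c * f j) m n = c * qConv Q d f m n := by
  unfold qConv
  rw [← tsum_mul_left]
  exact tsum_congr fun j => mul_assoc _ _ _

/-- Termwise this is 1 - ab = (1 - a) + a(1 - b) with a = Q^{m+dj}, b = Q^{n-dj}; each factor 1 - a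
or 1 - b lowers one index. The right-hand version exchanges the roles of a and b. -/
theorem qConv_pascal_left {Q : ℂ} (hQ : ‖Q‖ < 1) (hQ0 : Q ≠ 0) {d : ℤ} (hd : 0 < d)
    (f : ℤ → ℂ) (m n : ℤ) :
    (1 - Q ^ (m + n)) * qConv Q d f m n =
      qConv Q d f (m - 1) n + qConv Q d (fun j => f j * Q ^ (m + d * j)) m (n - 1) := by
  unfold qConv
  rw [← tsum_mul_left, ← (summable_qConv Q hd _ _ _).tsum_add (summable_qConv Q hd _ _ _)]
  refine tsum_congr fun j => ?_
  rw [show m - 1 + d * j = m + d * j - 1 by ring, show n - 1 - d * j = n - d * j - 1 by ring,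
    qRecip_sub_one hQ, qRecip_sub_one hQ, show m + n = (m + d * j) + (n - d * j) by ring,
    zpow_add₀ hQ0]
  ring

theorem qConv_pascal_right {Q : ℂ} (hQ : ‖Q‖ < 1) (hQ0 : Q ≠ 0) {d : ℤ} (hd : 0 < d)
    (f : ℤ → ℂ) (m n : ℤ) :
    (1 - Q ^ (m + n)) * qConv Q d f m n =
      qConv Q d f m (n - 1) + qConv Q d (fun j => f j * Q ^ (n - d * j)) (m - 1) n := by
  unfold qConv
  rw [← tsum_mul_left, ← (summable_qConv Q hd _ _ _).tsum_add (summable_qConv Q hd _ _ _)]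
  refine tsum_congr fun j => ?_
  rw [show m - 1 + d * j = m + d * j - 1 by ring, show n - 1 - d * j = n - d * j - 1 by ring,
    qRecip_sub_one hQ, qRecip_sub_one hQ, show m + n = (m + d * j) + (n - d * j) by ring,
    zpow_add₀ hQ0]
  ring

theorem qConv_mul_zpow {Q : ℂ} (hQ : ‖Q‖ < 1) {d : ℤ} (hd : 0 < d) (f : ℤ → ℂ) (m n : ℤ) :
    qConv Q d (fun j => f j * Q ^ (m + d * j)) m n = qConv Q d f m n - qConv Q d f (m - 1) n := by
  unfold qConv
  rw [← (summable_qConv Q hd _ _ _).tsum_sub (summable_qConv Q hd _ _ _)]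
  refine tsum_congr fun j => ?_
  rw [show m - 1 + d * j = m + d * j - 1 by ring, qRecip_sub_one hQ]
  ring

theorem qConv_zero_eq (Q : ℂ) {d n : ℤ} (hn : n < d) (hd : 0 < d) (f : ℤ → ℂ) :
    qConv Q d f 0 n = f 0 * qRecip Q n := by
  unfold qConv
  rw [tsum_eq_single 0]
  · simp [qRecip_zero]
  · intro j hj
    rcases lt_or_gt_of_ne hj with h | h
    · rw [qRecip_of_neg Q (k := 0 + d * j) (by nlinarith)]; simp
    · rw [qRecip_of_neg Q (k := n - d * j) (by nlinarith)]; simp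

/-! ### Theta series and the Jacobi triple product -/

/-- The general term `(-1)^k z^k s^{k^2 - k}` of a theta series. -/
noncomputable def thetaTerm (s z : ℂ) (k : ℤ) : ℂ := (-1) ^ k * z ^ k * s ^ (k ^ 2 - k)

theorem thetaTerm_zero (s z : ℂ) : thetaTerm s z 0 = 1 := by simp [thetaTerm]

theorem thetaTerm_add_one {s z : ℂ} (hs : s ≠ 0) (hz : z ≠ 0) (k : ℤ) :
    thetaTerm s z (k + 1) = -(z * (s ^ 2) ^ k) * thetaTerm s z k := by
  have h1 : (-1 : ℂ) ≠ 0 := by norm_num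
  have h2 : s ^ ((k + 1) ^ 2 - (k + 1)) = (s ^ 2) ^ k * s ^ (k ^ 2 - k) := by
    rw [← zpow_natCast s 2, ← zpow_mul, ← zpow_add₀ hs]
    congr 1
    push_cast
    ring
  rw [thetaTerm, thetaTerm, h2, zpow_add_one₀ h1, zpow_add_one₀ hz]
  ring

theorem thetaTerm_sub_one {s z : ℂ} (hs : s ≠ 0) (hz : z ≠ 0) (k : ℤ) :
    thetaTerm s z (k - 1) * (s ^ 2) ^ (k - 1) = -z⁻¹ * thetaTerm s z k := by
  have h := thetaTerm_add_one hs hz (k - 1)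
  rw [sub_add_cancel] at h
  rw [h]
  field_simp

/-- Reduces the negative half of a theta series to the nonnegative half of another one. -/
theorem thetaTerm_neg {s z : ℂ} (hs : s ≠ 0) (k : ℤ) :
    thetaTerm s z (-k) = thetaTerm s (s ^ 2 * z⁻¹) k := by
  have h1 : s ^ ((-k) ^ 2 - -k) = (s ^ 2) ^ k * s ^ (k ^ 2 - k) := by
    rw [← zpow_natCast s 2, ← zpow_mul, ← zpow_add₀ hs]
    congr 1
    push_cast
    ring
  rw [thetaTerm, thetaTerm, h1, mul_zpow, inv_zpow', zpow_neg, ← inv_zpow]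
  norm_num
  ring

theorem summable_norm_thetaTerm_nat {s z : ℂ} (hs : s ≠ 0) (hz : z ≠ 0) (hs1 : ‖s‖ < 1) :
    Summable fun k : ℕ => ‖thetaTerm s z k‖ := by
  have h0 : ∀ k : ℤ, thetaTerm s z k ≠ 0 := fun k => by
    unfold thetaTerm
    exact mul_ne_zero (mul_ne_zero (zpow_ne_zero _ (by norm_num)) (zpow_ne_zero _ hz))
      (zpow_ne_zero _ hs)
  have hs2 : ‖s ^ 2‖ < 1 := by
    rw [norm_pow]; exact pow_lt_one₀ (norm_nonneg _) hs1 (by norm_num)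
  refine (summable_of_ratio_test_tendsto_lt_one (l := 0) one_pos
    (Eventually.of_forall fun k : ℕ => h0 k) ?_).norm
  have h1 : ∀ k : ℕ, ‖thetaTerm s z (k + 1 : ℕ)‖ / ‖thetaTerm s z k‖ = ‖z‖ * ‖s ^ 2‖ ^ k := by
    intro k
    rw [Nat.cast_succ, thetaTerm_add_one hs hz, norm_mul, mul_div_assoc,
      div_self (norm_ne_zero_iff.mpr (h0 k)), mul_one, norm_neg, norm_mul, zpow_natCast,
      norm_pow _ k]
  simp only [h1]
  simpa using (tendsto_pow_atTop_nhds_zero_of_lt_one (norm_nonneg _) hs2).const_mul ‖z‖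

theorem summable_norm_thetaTerm {s z : ℂ} (hs : s ≠ 0) (hz : z ≠ 0) (hs1 : ‖s‖ < 1) :
    Summable fun k : ℤ => ‖thetaTerm s z k‖ := by
  refine Summable.of_nat_of_neg (summable_norm_thetaTerm_nat hs hz hs1) ?_
  simp only [thetaTerm_neg hs]
  exact summable_norm_thetaTerm_nat hs (by positivity) hs1

/-- The finite form of the Jacobi triple product identity. -/
theorem qPoch_mul_qConv_thetaTerm {s z : ℂ} (hs : s ≠ 0) (hz : z ≠ 0) (hs1 : ‖s‖ < 1) (N : ℕ) :
    qPoch (s ^ 2) (s ^ 2) (2 * N) * qConv (s ^ 2) 1 (thetaTerm s z) N N =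
      qPoch z (s ^ 2) N * qPoch (s ^ 2 * z⁻¹) (s ^ 2) N := by
  have hQ : ‖s ^ 2‖ < 1 := by
    rw [norm_pow]; exact pow_lt_one₀ (norm_nonneg _) hs1 (by norm_num)
  have hQ0 : s ^ 2 ≠ 0 := by positivity
  generalize hQs : s ^ 2 = Q at *
  induction N with
  | zero =>
    simp only [Nat.cast_zero, mul_zero, qPoch_zero, one_mul, mul_one]
    rw [qConv_zero_eq _ (by norm_num) (by norm_num), thetaTerm_zero, qRecip_zero, mul_one]
  | succ N ih =>
    -- The passage from N to N + 1 is made in two half-steps, through the indices (N, N + 1). In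
    -- each, a shift of j turns the extra q-power of the Pascal rule into a multiple of the same
    -- theta term, which produces one new factor of the product.
    have h1 : (1 - Q ^ (2 * N + 1)) * qConv Q 1 (thetaTerm s z) N (N + 1) =
        (1 - z * Q ^ N) * qConv Q 1 (thetaTerm s z) N N := by
      have h := qConv_pascal_right hQ hQ0 one_pos (thetaTerm s z) N (N + 1)
      rw [qConv_shift Q 1 _ (N - 1) (N + 1) 1] at h
      have e : (fun j : ℤ => thetaTerm s z (j + 1) * Q ^ ((N : ℤ) + 1 - 1 * (j + 1))) =
          fun j => (-(z * Q ^ N)) * thetaTerm s z j := by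
        funext j
        rw [thetaTerm_add_one hs hz, hQs, ← zpow_natCast Q N,
          show (N : ℤ) = j + (N + 1 - 1 * (j + 1)) by ring, zpow_add₀ hQ0]
        ring_nf
      rw [e, qConv_const_mul, show (N : ℤ) - 1 + 1 * 1 = N by ring,
        show (N : ℤ) + 1 - 1 * 1 = N by ring, show (N : ℤ) + 1 - 1 = N by ring,
        show (N : ℤ) + (N + 1) = ((2 * N + 1 : ℕ) : ℤ) by push_cast; ring, zpow_natCast] at h
      linear_combination h
    have h2 : (1 - Q ^ (2 * N + 2)) * qConv Q 1 (thetaTerm s z) (N + 1) (N + 1) =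
        (1 - z⁻¹ * Q ^ (N + 1)) * qConv Q 1 (thetaTerm s z) N (N + 1) := by
      have h := qConv_pascal_left hQ hQ0 one_pos (thetaTerm s z) (N + 1) (N + 1)
      rw [qConv_shift Q 1 _ (N + 1) (N + 1 - 1) (-1)] at h
      have e : (fun j : ℤ => thetaTerm s z (j + -1) * Q ^ ((N : ℤ) + 1 + 1 * (j + -1))) =
          fun j => (-(z⁻¹ * Q ^ (N + 1))) * thetaTerm s z j := by
        funext j
        have e1 := thetaTerm_sub_one hs hz j
        rw [hQs] at e1
        rw [← sub_eq_add_neg, one_mul, zpow_add₀ hQ0,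
          show (N : ℤ) + 1 = ((N + 1 : ℕ) : ℤ) by push_cast; rfl, zpow_natCast]
        linear_combination Q ^ (N + 1) * e1
      rw [e, qConv_const_mul, show (N : ℤ) + 1 - 1 - 1 * -1 = N + 1 by ring,
        show (N : ℤ) + 1 + 1 * -1 = N by ring, show (N : ℤ) + 1 - 1 = N by ring,
        show (N : ℤ) + 1 + (N + 1) = ((2 * N + 2 : ℕ) : ℤ) by push_cast; ring, zpow_natCast] at h
      linear_combination h
    rw [show 2 * (N + 1) = 2 * N + 1 + 1 by ring, qPoch_succ, qPoch_succ, qPoch_succ, qPoch_succ]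
    push_cast
    have e1 : Q * Q ^ (2 * N) = Q ^ (2 * N + 1) := by ring
    have e2 : Q * Q ^ (2 * N + 1) = Q ^ (2 * N + 2) := by ring
    rw [e1, e2]
    linear_combination qPoch Q Q (2 * N) * (1 - Q ^ (2 * N + 1)) * h2 +
      qPoch Q Q (2 * N) * (1 - z⁻¹ * Q ^ (N + 1)) * h1 +
      (1 - z⁻¹ * Q ^ (N + 1)) * (1 - z * Q ^ N) * ih

/-- Dominated convergence: both reciprocals tend to 1/(Q;Q)_∞ and are uniformly bounded, so f itself
supplies the majorant. -/
theorem tendsto_qConv {Q : ℂ} (hQ : ‖Q‖ < 1) (d : ℤ) {f : ℤ → ℂ} (hf : Summable fun j => ‖f j‖) :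
    Tendsto (fun N : ℕ => qConv Q d f N N) atTop
      (𝓝 (∑' j, f j * ((qPochInf Q Q)⁻¹ * (qPochInf Q Q)⁻¹))) := by
  obtain ⟨C, hC0, hC⟩ := exists_norm_qRecip_le hQ
  refine tendsto_tsum_of_dominated_convergence (bound := fun j => ‖f j‖ * (C * C))
    (hf.mul_right _) (fun j => ?_) (Eventually.of_forall fun N j => ?_)
  · refine (Tendsto.mul ?_ ?_).const_mul _
    · exact tendsto_qRecip_comp hQ (tendsto_natCast_atTop_atTop.atTop_add tendsto_const_nhds)
    · exact tendsto_qRecip_comp hQ (tendsto_natCast_atTop_atTop.atTop_add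
        (tendsto_const_nhds (x := -(d * j))))
  · rw [norm_mul, norm_mul]
    gcongr
    · exact hC _
    · exact hC _

/-- The Jacobi triple product identity. -/
theorem tsum_thetaTerm {s z : ℂ} (hs : s ≠ 0) (hz : z ≠ 0) (hs1 : ‖s‖ < 1) :
    ∑' k, thetaTerm s z k = qPochInf₃ z (s ^ 2 * z⁻¹) (s ^ 2) (s ^ 2) := by
  have hQ : ‖s ^ 2‖ < 1 := by
    rw [norm_pow]; exact pow_lt_one₀ (norm_nonneg _) hs1 (by norm_num)
  have h0 := qPochInf_self_ne_zero hQ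
  have h1 := ((tendsto_qPoch (s ^ 2) hQ).comp (tendsto_id.const_mul_atTop' two_pos)).mul
    (tendsto_qConv hQ 1 (summable_norm_thetaTerm hs hz hs1))
  have h2 := (tendsto_qPoch z hQ).mul (tendsto_qPoch (s ^ 2 * z⁻¹) hQ)
  have h3 := tendsto_nhds_unique (h1.congr fun N => by
    simpa using qPoch_mul_qConv_thetaTerm hs hz hs1 N) h2
  rw [tsum_mul_right] at h3
  rw [qPochInf₃, ← h3]
  field_simp

/-! ### Bressoud's finite identity -/

/-- Up to 1/(Q;Q)_n these sums are Rogers–Szegő polynomials at powers of Q. Together with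
`qConv_rogers_odd`, this recurrence mirrors those of the pentagonal sums. -/
theorem qConv_rogers_even {Q : ℂ} (hQ : ‖Q‖ < 1) (hQ0 : Q ≠ 0) (N : ℕ) :
    (1 - Q ^ (N + 1)) * qConv Q 1 (fun j => Q ^ (j * (N + 1))) 0 (N + 1) =
      Q ^ (2 * N + 1) * qConv Q 1 (fun j => Q ^ (j * N)) 0 N +
        qConv Q 1 (fun j => Q ^ (j * (N + 1))) 0 N := by
  have h := qConv_pascal_right hQ hQ0 one_pos (fun j => Q ^ (j * ((N : ℤ) + 1))) 0 (N + 1)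
  rw [qConv_shift Q 1 _ (0 - 1) (N + 1) 1] at h
  have e : (fun j : ℤ => Q ^ ((j + 1) * ((N : ℤ) + 1)) * Q ^ ((N : ℤ) + 1 - 1 * (j + 1))) =
      fun j : ℤ => Q ^ (2 * N + 1) * Q ^ (j * N) := by
    funext j
    rw [← zpow_natCast Q (2 * N + 1), ← zpow_add₀ hQ0, ← zpow_add₀ hQ0]
    congr 1
    push_cast
    ring
  rw [e, qConv_const_mul, show (0 : ℤ) - 1 + 1 * 1 = 0 by ring,
    show (N : ℤ) + 1 - 1 * 1 = N by ring, show (N : ℤ) + 1 - 1 = N by ring,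
    show (0 : ℤ) + (N + 1) = ((N + 1 : ℕ) : ℤ) by push_cast; ring, zpow_natCast] at h
  linear_combination h

theorem qConv_rogers_odd {Q : ℂ} (hQ : ‖Q‖ < 1) (hQ0 : Q ≠ 0) (N : ℕ) :
    qConv Q 1 (fun j => Q ^ (j * (N + 2))) 0 (N + 1) =
      qConv Q 1 (fun j => Q ^ (j * (N + 1))) 0 (N + 1) -
        Q ^ (N + 1) * qConv Q 1 (fun j => Q ^ (j * (N + 1))) 0 N := by
  have h := qConv_mul_zpow hQ one_pos (fun j => Q ^ (j * ((N : ℤ) + 1))) 0 (N + 1)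
  rw [qConv_shift Q 1 _ (0 - 1) (N + 1) 1] at h
  have e : (fun j : ℤ => Q ^ (j * ((N : ℤ) + 1)) * Q ^ (0 + 1 * j)) =
      fun j => Q ^ (j * ((N : ℤ) + 2)) := by
    funext j
    rw [← zpow_add₀ hQ0]
    congr 1
    ring
  have e' : (fun j : ℤ => Q ^ ((j + 1) * ((N : ℤ) + 1))) =
      fun j => Q ^ (N + 1) * Q ^ (j * ((N : ℤ) + 1)) := by
    funext j
    rw [← zpow_natCast Q (N + 1), ← zpow_add₀ hQ0]
    congr 1
    push_cast
    ring
  rw [e, e', qConv_const_mul, show (0 : ℤ) - 1 + 1 * 1 = 0 by ring,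
    show (N : ℤ) + 1 - 1 * 1 = N by ring] at h
  exact h

/-- The general term `(-1)^j q^{3 j^2 - j}` of the pentagonal theta series in base `q^2`. -/
noncomputable def pentTerm (q : ℂ) (j : ℤ) : ℂ := (-1) ^ j * q ^ (3 * j ^ 2 - j)

theorem pentTerm_mul_zpow {q : ℂ} (hq : q ≠ 0) (j e : ℤ) :
    pentTerm q j * (q ^ 2) ^ e = (-1) ^ j * q ^ (3 * j ^ 2 - j + 2 * e) := by
  rw [pentTerm, ← zpow_natCast q 2, ← zpow_mul, mul_assoc, ← zpow_add₀ hq]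
  rfl

theorem neg_one_zpow_sub (c j : ℤ) : (-1 : ℂ) ^ (c - j) = (-1) ^ c * (-1) ^ j := by
  rw [zpow_sub₀ (by norm_num), div_eq_mul_inv, ← inv_zpow]
  norm_num

/-- Two Pascal steps leave one unwanted sum, at indices (N + 1, N - 1). It is antisymmetric under j
↦ -1 - j, hence zero. -/
theorem qConv_pent_even {q : ℂ} (hq : ‖q‖ < 1) (hq0 : q ≠ 0) (N : ℕ) :
    (1 - (q ^ 2) ^ (2 * N + 2)) * (1 - (q ^ 2) ^ (2 * N + 1)) *
        qConv (q ^ 2) 2 (pentTerm q) (N + 1) (N + 1) =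
      (1 - (q ^ 2) ^ (2 * N + 1)) * qConv (q ^ 2) 2 (pentTerm q) N (N + 1) +
        (q ^ 2) ^ (2 * N + 1) * qConv (q ^ 2) 2 (pentTerm q) N N := by
  have hQ : ‖q ^ 2‖ < 1 := by
    rw [norm_pow]; exact pow_lt_one₀ (norm_nonneg _) hq (by norm_num)
  have hQ0 : q ^ 2 ≠ 0 := by positivity
  have h1 := qConv_pascal_left hQ hQ0 two_pos (pentTerm q) (N + 1) (N + 1)
  have h2 := qConv_pascal_right hQ hQ0 two_pos
    (fun j => pentTerm q j * (q ^ 2) ^ ((N : ℤ) + 1 + 2 * j)) (N + 1) (N + 1 - 1)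
  have h3 := qConv_reflect (q ^ 2) 2
    (fun j => pentTerm q j * (q ^ 2) ^ ((N : ℤ) + 1 + 2 * j)) (N + 1) (N + 1 - 1 - 1) (-1)
  have e1 : (fun j : ℤ => pentTerm q (-1 - j) * (q ^ 2) ^ ((N : ℤ) + 1 + 2 * (-1 - j))) =
      fun j => (-1) * (pentTerm q j * (q ^ 2) ^ ((N : ℤ) + 1 + 2 * j)) := by
    funext j
    rw [pentTerm_mul_zpow hq0, pentTerm_mul_zpow hq0, neg_one_zpow_sub,
      show 3 * (-1 - j) ^ 2 - (-1 - j) + 2 * ((N : ℤ) + 1 + 2 * (-1 - j)) =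
        3 * j ^ 2 - j + 2 * ((N : ℤ) + 1 + 2 * j) by ring]
    norm_num
  have e2 : (fun j : ℤ => pentTerm q j * (q ^ 2) ^ ((N : ℤ) + 1 + 2 * j) *
      (q ^ 2) ^ ((N : ℤ) + 1 - 1 - 2 * j)) = fun j => (q ^ 2) ^ (2 * N + 1) * pentTerm q j := by
    funext j
    rw [mul_assoc, ← zpow_add₀ hQ0, mul_comm, ← zpow_natCast (q ^ 2)]
    congr 2
    push_cast
    ring
  rw [e1, qConv_const_mul, show (N : ℤ) + 1 - 1 - 1 - 2 * -1 = N + 1 by ring,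
    show (N : ℤ) + 1 + 2 * -1 = N + 1 - 1 - 1 by ring] at h3
  rw [e2, qConv_const_mul] at h2
  rw [show (N : ℤ) + 1 + (N + 1 - 1) = ((2 * N + 1 : ℕ) : ℤ) by push_cast; ring, zpow_natCast,
    show (N : ℤ) + 1 - 1 = N by ring] at h2
  rw [show (N : ℤ) + 1 - 1 = N by ring] at h3
  rw [show (N : ℤ) + 1 + (N + 1) = ((2 * N + 2 : ℕ) : ℤ) by push_cast; ring, zpow_natCast,
    show (N : ℤ) + 1 - 1 = N by ring] at h1
  -- `h3` has the form X = -X, so half of it eliminates X.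
  linear_combination (1 - (q ^ 2) ^ (2 * N + 1)) * h1 + h2 + h3 / 2

/-- Here j ↦ 1 - j does not kill the leftover sum but sends it to -Q^{N+1} times the pentagonal sum
at (N, N + 1). -/
theorem qConv_pent_odd {q : ℂ} (hq : ‖q‖ < 1) (hq0 : q ≠ 0) (N : ℕ) :
    (1 - (q ^ 2) ^ (2 * N + 2)) * (1 - (q ^ 2) ^ (2 * N + 3)) *
        qConv (q ^ 2) 2 (pentTerm q) (N + 1) (N + 2) =
      (1 - (q ^ 2) ^ (2 * N + 2)) * qConv (q ^ 2) 2 (pentTerm q) (N + 1) (N + 1) +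
        ((q ^ 2) ^ (2 * N + 2) - (q ^ 2) ^ (N + 1)) * qConv (q ^ 2) 2 (pentTerm q) N (N + 1) := by
  have hQ : ‖q ^ 2‖ < 1 := by
    rw [norm_pow]; exact pow_lt_one₀ (norm_nonneg _) hq (by norm_num)
  have hQ0 : q ^ 2 ≠ 0 := by positivity
  have h1 := qConv_pascal_right hQ hQ0 two_pos (pentTerm q) (N + 1) (N + 2)
  have h2 := qConv_pascal_left hQ hQ0 two_pos
    (fun j => pentTerm q j * (q ^ 2) ^ ((N : ℤ) + 2 - 2 * j)) N (N + 2)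
  have h3 := qConv_reflect (q ^ 2) 2
    (fun j => pentTerm q j * (q ^ 2) ^ ((N : ℤ) + 2 - 2 * j)) (N - 1) (N + 2) 1
  have e1 : (fun j : ℤ => pentTerm q (1 - j) * (q ^ 2) ^ ((N : ℤ) + 2 - 2 * (1 - j))) =
      fun j => (-(q ^ 2) ^ (N + 1)) * pentTerm q j := by
    funext j
    rw [pentTerm_mul_zpow hq0, neg_one_zpow_sub, neg_mul, mul_comm _ (pentTerm q j),
      ← zpow_natCast (q ^ 2), pentTerm_mul_zpow hq0,
      show 3 * (1 - j) ^ 2 - (1 - j) + 2 * ((N : ℤ) + 2 - 2 * (1 - j)) =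
        3 * j ^ 2 - j + 2 * ((N + 1 : ℕ) : ℤ) by push_cast; ring]
    norm_num
  have e2 : (fun j : ℤ => pentTerm q j * (q ^ 2) ^ ((N : ℤ) + 2 - 2 * j) *
      (q ^ 2) ^ ((N : ℤ) + 2 * j)) = fun j => (q ^ 2) ^ (2 * N + 2) * pentTerm q j := by
    funext j
    rw [mul_assoc, ← zpow_add₀ hQ0, mul_comm, ← zpow_natCast (q ^ 2)]
    congr 2
    push_cast
    ring
  rw [e1, qConv_const_mul, show (N : ℤ) + 2 - 2 * 1 = N by ring,
    show (N : ℤ) - 1 + 2 * 1 = N + 1 by ring] at h3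
  rw [e2, qConv_const_mul] at h2
  rw [show (N : ℤ) + (N + 2) = ((2 * N + 2 : ℕ) : ℤ) by push_cast; ring, zpow_natCast,
    show (N : ℤ) + 2 - 1 = N + 1 by ring] at h2
  rw [show (N : ℤ) + 1 + (N + 2) = ((2 * N + 3 : ℕ) : ℤ) by push_cast; ring, zpow_natCast,
    show (N : ℤ) + 2 - 1 = N + 1 by ring, show (N : ℤ) + 1 - 1 = N by ring] at h1
  linear_combination (1 - (q ^ 2) ^ (2 * N + 2)) * h1 + h2 + h3

/-- A finite Rogers–Ramanujan identity of Bressoud, with `q` replaced by `1 / q`. -/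
theorem qPoch_mul_qConv_pent {q : ℂ} (hq : ‖q‖ < 1) (hq0 : q ≠ 0) (N : ℕ) :
    qPoch (q ^ 2) (q ^ 2) (2 * N) * qConv (q ^ 2) 2 (pentTerm q) N N =
        qPoch (q ^ 2) (q ^ 2) N * qConv (q ^ 2) 1 (fun j => (q ^ 2) ^ (j * N)) 0 N ∧
      qPoch (q ^ 2) (q ^ 2) (2 * N + 1) * qConv (q ^ 2) 2 (pentTerm q) N (N + 1) =
        qPoch (q ^ 2) (q ^ 2) N * qConv (q ^ 2) 1 (fun j => (q ^ 2) ^ (j * (N + 1))) 0 N := by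
  have hQ : ‖q ^ 2‖ < 1 := by
    rw [norm_pow]; exact pow_lt_one₀ (norm_nonneg _) hq (by norm_num)
  have hQ0 : q ^ 2 ≠ 0 := by positivity
  induction N with
  | zero =>
    have h1 := one_sub_pow_succ_ne_zero hQ 0
    have h2 : qRecip (q ^ 2) (0 + 1) = (1 - q ^ 2)⁻¹ := by
      rw [zero_add, ← Nat.cast_one, qRecip_natCast, qPoch_succ, qPoch_zero]
      simp
    simp only [Nat.cast_zero]
    rw [qConv_zero_eq _ (by norm_num) (by norm_num), qConv_zero_eq _ (by norm_num) (by norm_num),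
      qConv_zero_eq _ (by norm_num) (by norm_num), qConv_zero_eq _ (by norm_num) (by norm_num), h2,
      qPoch_succ]
    simp only [zero_add, pow_one] at h1
    simp [qPoch_zero, qRecip_zero, pentTerm, h1]
  | succ N ih =>
    obtain ⟨ihA, ihB⟩ := ih
    have rA := qConv_rogers_even hQ hQ0 N
    have rB := qConv_rogers_odd hQ hQ0 N
    have pA := qConv_pent_even hq hq0 N
    have pB := qConv_pent_odd hq hq0 N
    generalize q ^ 2 = Q at *
    have e1 : Q * Q ^ (2 * N) = Q ^ (2 * N + 1) := by ring
    have e2 : Q * Q ^ (2 * N + 1) = Q ^ (2 * N + 2) := by ring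
    have e3 : Q * Q ^ (2 * N + 2) = Q ^ (2 * N + 3) := by ring
    have e4 : Q * Q ^ N = Q ^ (N + 1) := by ring
    have p1 : qPoch Q Q (2 * N + 1) = qPoch Q Q (2 * N) * (1 - Q ^ (2 * N + 1)) := by
      rw [qPoch_succ, e1]
    have p2 : qPoch Q Q (2 * N + 2) = qPoch Q Q (2 * N + 1) * (1 - Q ^ (2 * N + 2)) := by
      rw [qPoch_succ, e2]
    have p3 : qPoch Q Q (2 * N + 3) = qPoch Q Q (2 * N + 2) * (1 - Q ^ (2 * N + 3)) := by
      rw [qPoch_succ, e3]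
    have p4 : qPoch Q Q (N + 1) = qPoch Q Q N * (1 - Q ^ (N + 1)) := by rw [qPoch_succ, e4]
    have c1 : ((N + 1 : ℕ) : ℤ) = (N : ℤ) + 1 := by push_cast; rfl
    have c2 : (N : ℤ) + 1 + 1 = N + 2 := by ring
    rw [c1, c2, show 2 * (N + 1) = 2 * N + 2 by ring, show 2 * N + 2 + 1 = 2 * N + 3 by ring]
    -- The two families are interlaced: the even case at N + 1 needs both cases at N, and the odd
    -- case at N + 1 then uses this new even case.
    have A : qPoch Q Q (2 * N + 2) * qConv Q 2 (pentTerm q) (N + 1) (N + 1) =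
        qPoch Q Q (N + 1) * qConv Q 1 (fun j => Q ^ (j * ((N : ℤ) + 1))) 0 (N + 1) := by
      rw [p1] at ihB
      rw [p2, p1, p4]
      linear_combination qPoch Q Q (2 * N) * pA + ihB + Q ^ (2 * N + 1) * ihA - qPoch Q Q N * rA
    refine ⟨A, ?_⟩
    have hsq : Q ^ (2 * N + 2) = Q ^ (N + 1) * Q ^ (N + 1) := by ring
    rw [p2] at A
    rw [p3, p2, rB]
    rw [p4] at A ⊢
    linear_combination qPoch Q Q (2 * N + 1) * pB + A +
      (Q ^ (2 * N + 2) - Q ^ (N + 1)) * ihB +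
      (qPoch Q Q N * qConv Q 1 (fun j => Q ^ (j * ((N : ℤ) + 1))) 0 N) * hsq

theorem norm_sq_lt_one {q : ℂ} (hq : ‖q‖ < 1) : ‖q ^ 2‖ < 1 := by
  rw [norm_pow]; exact pow_lt_one₀ (norm_nonneg _) hq (by norm_num)

theorem qConv_one_eq_sum_antidiagonal (Q : ℂ) (f : ℤ → ℂ) (N : ℕ) :
    qConv Q 1 f 0 N = ∑ p ∈ antidiagonal N, f p.2 * (qRecip Q p.2 * qRecip Q p.1) := by
  rw [← Finset.Nat.sum_antidiagonal_swap, Finset.Nat.sum_antidiagonal_eq_sum_range_succ_mk]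
  unfold qConv
  rw [tsum_eq_sum (s := (Finset.range (N + 1)).map Nat.castEmbedding)]
  · rw [Finset.sum_map]
    refine Finset.sum_congr rfl fun k hk => ?_
    have hk' : k ≤ N := by simpa [Nat.lt_succ_iff] using hk
    simp [Nat.cast_sub hk']
  · intro j hj
    rcases lt_or_ge j 0 with h | h
    · rw [qRecip_of_neg Q (k := 0 + 1 * j) (by omega)]; simp
    · lift j to ℕ using h
      have hN : N < j := by
        by_contra hcon
        exact hj (by simpa using by omega)
      rw [qRecip_of_neg Q (k := (N : ℤ) - 1 * j) (by omega)]; simp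

/-! ### The conjugate Bailey pair -/

/-- The weight `(-q; q^2)_N q^{N^2}`. -/
noncomputable def baileyWeight (q : ℂ) (N : ℕ) : ℂ := qPoch (-q) (q ^ 2) N * q ^ N ^ 2

theorem baileyWeight_succ (q : ℂ) (N : ℕ) :
    baileyWeight q (N + 1) = (1 + q ^ (2 * N + 1)) * q ^ (2 * N + 1) * baileyWeight q N := by
  rw [baileyWeight, baileyWeight, qPoch_succ]
  ring

theorem summable_norm_baileyWeight {q : ℂ} (hq : ‖q‖ < 1) :
    Summable fun N => ‖baileyWeight q N‖ := by
  obtain ⟨C, hC⟩ := exists_norm_le_of_tendsto (tendsto_qPoch (-q) (norm_sq_lt_one hq))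
  refine Summable.of_nonneg_of_le (fun _ => norm_nonneg _) (fun N => ?_)
    ((summable_geometric_of_lt_one (norm_nonneg q) hq).mul_left C)
  rw [baileyWeight, norm_mul, norm_pow]
  have h1 : ‖q‖ ^ N ^ 2 ≤ ‖q‖ ^ N :=
    pow_le_pow_of_le_one (norm_nonneg _) hq.le (Nat.le_self_pow (by norm_num) N)
  exact mul_le_mul (hC N) h1 (by positivity) ((norm_nonneg _).trans (hC N))

theorem summable_baileyWeight_mul {q : ℂ} (hq : ‖q‖ < 1) (u v : ℕ → ℤ) :
    Summable fun N => baileyWeight q N * (qRecip (q ^ 2) (u N) * qRecip (q ^ 2) (v N)) := by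
  obtain ⟨C, hC0, hC⟩ := exists_norm_qRecip_le (norm_sq_lt_one hq)
  refine Summable.of_norm_bounded ((summable_norm_baileyWeight hq).mul_right (C * C)) fun N => ?_
  rw [norm_mul, norm_mul]
  gcongr
  · exact hC _
  · exact hC _

/-- The sum `∑_N (-q; q^2)_N q^{N^2} / ((q^2; q^2)_{N + k} (q^2; q^2)_{N - k})`. -/
noncomputable def baileySum (q : ℂ) (k : ℤ) : ℂ :=
  ∑' N : ℕ, baileyWeight q N * (qRecip (q ^ 2) (N + k) * qRecip (q ^ 2) (N - k))

theorem baileySum_neg (q : ℂ) (k : ℤ) : baileySum q (-k) = baileySum q k := by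
  refine tsum_congr fun N => ?_
  rw [mul_comm (qRecip _ _), sub_neg_eq_add, ← sub_eq_add_neg]

/-- Creative telescoping: termwise, the difference of the two sides is a constant multiple of T(N +
1) - T(N) for an explicit summable T with T(0) = 0. -/
theorem baileySum_add_one {q : ℂ} (hq : ‖q‖ < 1) (hq0 : q ≠ 0) (k : ℕ) :
    baileySum q (k + 1) = q ^ (2 * k + 1) * baileySum q k := by
  have hQ := norm_sq_lt_one hq
  have hQ0 : q ^ 2 ≠ 0 := by positivity
  set T : ℕ → ℂ := fun N =>
    baileyWeight q N * (qRecip (q ^ 2) (N - k - 1) * qRecip (q ^ 2) (N + k)) with hT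
  have hTs : Summable T := summable_baileyWeight_mul hq _ _
  -- This uses k ≥ 0: the index -k - 1 is negative.
  have hT0 : T 0 = 0 := by
    simp only [hT]
    rw [qRecip_of_neg _ (k := ((0 : ℕ) : ℤ) - k - 1) (by push_cast; omega)]
    simp
  have hs1 := summable_baileyWeight_mul hq (fun N => N + (k + 1)) (fun N => N - (k + 1))
  have hs2 := summable_baileyWeight_mul hq (fun N => N + k) (fun N => N - k)
  have key : ∀ N : ℕ,
      baileyWeight q N * (qRecip (q ^ 2) (N + (k + 1)) * qRecip (q ^ 2) (N - (k + 1))) -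
        q ^ (2 * k + 1) * (baileyWeight q N * (qRecip (q ^ 2) (N + k) * qRecip (q ^ 2) (N - k))) =
      -(1 - q ^ (2 * k + 1)) * (T (N + 1) - T N) := by
    intro N
    simp only [hT]
    have e1 := qRecip_sub_one hQ ((N : ℤ) - k)
    have e2 := qRecip_sub_one hQ ((N : ℤ) + k + 1)
    rw [add_sub_cancel_right] at e2
    rw [baileyWeight_succ, show (N : ℤ) + (k + 1) = N + k + 1 by ring,
      show (N : ℤ) - (k + 1) = N - k - 1 by ring, e1, e2,
      show ((N + 1 : ℕ) : ℤ) - k - 1 = N - k by push_cast; ring,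
      show ((N + 1 : ℕ) : ℤ) + k = N + k + 1 by push_cast; ring, zpow_sub₀ hQ0,
      zpow_add₀ hQ0, zpow_add₀ hQ0, zpow_one, zpow_natCast, zpow_natCast, ← pow_mul, ← pow_mul]
    have hk : q ^ (2 * k) ≠ 0 := pow_ne_zero _ hq0
    rw [pow_succ q (2 * k), pow_succ q (2 * N)]
    field_simp
    ring
  have h1 := hTs.tsum_eq_zero_add
  rw [hT0, zero_add] at h1
  have h2 : ∑' N : ℕ, -(1 - q ^ (2 * k + 1)) * (T (N + 1) - T N) = 0 := by
    rw [tsum_mul_left, ((summable_nat_add_iff 1).mpr hTs).tsum_sub hTs, ← h1, sub_self, mul_zero]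
  rw [← tsum_congr key, hs1.tsum_sub (hs2.mul_left _), tsum_mul_left] at h2
  exact sub_eq_zero.mp h2

theorem baileySum_eq_pow_mul_zero {q : ℂ} (hq : ‖q‖ < 1) (hq0 : q ≠ 0) (k : ℕ) :
    baileySum q k = q ^ k ^ 2 * baileySum q 0 := by
  induction k with
  | zero => simp
  | succ k ih =>
    rw [Nat.cast_succ, baileySum_add_one hq hq0, ih]
    ring

/-- Terms with N < n vanish; substituting N = M + n exposes the factor q^{n²}. -/
theorem baileySum_eq_pow_mul_tsum {q : ℂ} (hq : ‖q‖ < 1) (n : ℕ) :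
    baileySum q n = q ^ n ^ 2 * ∑' M : ℕ, qPoch (-q) (q ^ 2) (M + n) * q ^ (M ^ 2 + 2 * M * n) *
      (qRecip (q ^ 2) (M + 2 * n : ℕ) * qRecip (q ^ 2) M) := by
  have hs := summable_baileyWeight_mul hq (fun N => N + n) (fun N => N - n)
  rw [baileySum, ← hs.sum_add_tsum_nat_add n, Finset.sum_eq_zero, zero_add, ← tsum_mul_left]
  · refine tsum_congr fun M => ?_
    rw [baileyWeight, show ((M + n : ℕ) : ℤ) + n = (M + 2 * n : ℕ) by push_cast; ring,
      show ((M + n : ℕ) : ℤ) - n = M by push_cast; ring]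
    ring
  · intro N hN
    rw [Finset.mem_range] at hN
    rw [qRecip_of_neg _ (k := (N : ℤ) - n) (by omega)]
    simp

/-- The sum at n, divided by q^{n²}, does not depend on n, so it may be evaluated as n → ∞. The
factor q^{M²+2Mn} then kills every term but M = 0. -/
theorem baileySum_zero {q : ℂ} (hq : ‖q‖ < 1) (hq0 : q ≠ 0) :
    baileySum q 0 = qPochInf (-q) (q ^ 2) / qPochInf (q ^ 2) (q ^ 2) := by
  have hQ := norm_sq_lt_one hq
  have h1 : ∀ n : ℕ, ∑' M : ℕ, qPoch (-q) (q ^ 2) (M + n) * q ^ (M ^ 2 + 2 * M * n) *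
      (qRecip (q ^ 2) (M + 2 * n : ℕ) * qRecip (q ^ 2) M) = baileySum q 0 := fun n =>
    mul_left_cancel₀ (pow_ne_zero (n ^ 2) hq0)
      ((baileySum_eq_pow_mul_tsum hq n).symm.trans (baileySum_eq_pow_mul_zero hq hq0 n))
  obtain ⟨C, hC⟩ := exists_norm_le_of_tendsto (tendsto_qPoch (-q) hQ)
  obtain ⟨D, hD0, hD⟩ := exists_norm_qRecip_le hQ
  have h2 : Tendsto (fun n : ℕ => ∑' M : ℕ, qPoch (-q) (q ^ 2) (M + n) *
      q ^ (M ^ 2 + 2 * M * n) * (qRecip (q ^ 2) (M + 2 * n : ℕ) * qRecip (q ^ 2) M)) atTop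
      (𝓝 (∑' M : ℕ, if M = 0 then qPochInf (-q) (q ^ 2) / qPochInf (q ^ 2) (q ^ 2) else 0)) := by
    refine tendsto_tsum_of_dominated_convergence (bound := fun M => C * ‖q‖ ^ M * (D * D))
      (((summable_geometric_of_lt_one (norm_nonneg q) hq).mul_left C).mul_right _)
      (fun M => ?_) (Eventually.of_forall fun n M => ?_)
    · have t1 : Tendsto (fun n => qPoch (-q) (q ^ 2) (M + n)) atTop
          (𝓝 (qPochInf (-q) (q ^ 2))) :=
        (tendsto_qPoch (-q) hQ).comp (tendsto_atTop_mono (fun n => Nat.le_add_left n M) tendsto_id)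
      have t2 : Tendsto (fun n : ℕ => qRecip (q ^ 2) (M + 2 * n : ℕ)) atTop
          (𝓝 (qPochInf (q ^ 2) (q ^ 2))⁻¹) :=
        (tendsto_qRecip hQ).comp
          ((tendsto_atTop_mono (fun n => Nat.le_add_left n M) tendsto_id).comp (tendsto_id.const_mul_atTop' two_pos))
      rcases Nat.eq_zero_or_pos M with rfl | hM
      · simpa [qRecip_zero, div_eq_mul_inv] using t1.mul t2
      · have t3 : Tendsto (fun n : ℕ => q ^ (M ^ 2 + 2 * M * n)) atTop (𝓝 0) := by
          refine (tendsto_pow_atTop_nhds_zero_of_norm_lt_one hq).comp ?_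
          exact (tendsto_atTop_mono (fun n => Nat.le_add_left n (M ^ 2)) tendsto_id).comp
            (tendsto_id.const_mul_atTop' (by positivity))
        simpa [hM.ne'] using (t1.mul t3).mul (t2.mul_const (qRecip (q ^ 2) M))
    · rw [norm_mul, norm_mul, norm_mul, norm_pow]
      have hC0 : 0 ≤ C := (norm_nonneg _).trans (hC 0)
      have hp : ‖q‖ ^ (M ^ 2 + 2 * M * n) ≤ ‖q‖ ^ M :=
        pow_le_pow_of_le_one (norm_nonneg _) hq.le
          ((Nat.le_self_pow (by norm_num) M).trans (Nat.le_add_right _ _))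
      gcongr
      · exact hC _
      · exact hD _
      · exact hD _
  simp only [h1, tsum_ite_eq] at h2
  exact tendsto_nhds_unique tendsto_const_nhds h2

theorem baileySum_eq {q : ℂ} (hq : ‖q‖ < 1) (hq0 : q ≠ 0) (k : ℤ) :
    baileySum q k =
      q ^ k ^ 2 * (qPochInf (-q) (q ^ 2) / qPochInf (q ^ 2) (q ^ 2)) := by
  rw [← baileySum_zero hq hq0]
  obtain ⟨n, rfl | rfl⟩ := k.eq_nat_or_neg
  · rw [baileySum_eq_pow_mul_zero hq hq0]
    norm_cast
  · rw [baileySum_neg, baileySum_eq_pow_mul_zero hq hq0, neg_sq]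
    norm_cast

/-! ### Exchange of summations and the double series -/

theorem pentTerm_eq_thetaTerm {q : ℂ} (hq0 : q ≠ 0) (j : ℤ) :
    pentTerm q j = thetaTerm (q ^ 3) (q ^ 2) j := by
  rw [pentTerm, thetaTerm, ← zpow_natCast q 2, ← zpow_natCast q 3, ← zpow_mul, ← zpow_mul,
    mul_assoc, ← zpow_add₀ hq0]
  congr 2
  push_cast
  ring

theorem pentTerm_mul_zpow_sq {q : ℂ} (hq0 : q ≠ 0) (j : ℤ) :
    pentTerm q j * q ^ (2 * j) ^ 2 = thetaTerm (q ^ 7) (q ^ 6) j := by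
  rw [pentTerm, thetaTerm, ← zpow_natCast q 7, ← zpow_natCast q 6, ← zpow_mul, ← zpow_mul,
    mul_assoc, mul_assoc, ← zpow_add₀ hq0, ← zpow_add₀ hq0]
  congr 2
  push_cast
  ring

/-- Absolute summability over (N, j) allows summing over N first; this contributes q^{4j²}, turning
3j² - j into 7j² - j, the theta exponent for s = q^7, z = q^6. -/
theorem tsum_baileyWeight_mul_qConv {q : ℂ} (hq : ‖q‖ < 1) (hq0 : q ≠ 0) :
    ∑' N : ℕ, baileyWeight q N * qConv (q ^ 2) 2 (pentTerm q) N N =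
      qPochInf₃ (q ^ 6) (q ^ 8) (q ^ 14) (q ^ 14) * qPochInf (-q) (q ^ 2) /
        qPochInf (q ^ 2) (q ^ 2) := by
  have hQ := norm_sq_lt_one hq
  obtain ⟨D, hD0, hD⟩ := exists_norm_qRecip_le hQ
  have hs : Summable fun p : ℕ × ℤ => pentTerm q p.2 * (baileyWeight q p.1 *
      (qRecip (q ^ 2) (p.1 + 2 * p.2) * qRecip (q ^ 2) (p.1 - 2 * p.2))) := by
    have h3 : ‖q ^ 3‖ < 1 := by
      rw [norm_pow]; exact pow_lt_one₀ (norm_nonneg _) hq (by norm_num)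
    have hp : Summable fun j => ‖pentTerm q j‖ := by
      simp only [pentTerm_eq_thetaTerm hq0]
      exact summable_norm_thetaTerm (by positivity) (by positivity) h3
    refine Summable.of_norm_bounded
      (((summable_norm_baileyWeight hq).mul_right (D * D)).mul_of_nonneg hp
        (fun N => by positivity) (fun j => norm_nonneg _)) fun p => ?_
    rw [norm_mul, norm_mul, norm_mul, mul_comm]
    gcongr
    · exact hD _
    · exact hD _
  have h7 : ‖q ^ 7‖ < 1 := by
    rw [norm_pow]; exact pow_lt_one₀ (norm_nonneg _) hq (by norm_num)
  have h14 : (q ^ 7) ^ 2 = q ^ 14 := by ring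
  have h8 : q ^ 14 * (q ^ 6)⁻¹ = q ^ 8 := by field_simp
  have hT := tsum_thetaTerm (s := q ^ 7) (z := q ^ 6) (by positivity) (by positivity) h7
  rw [h14, h8] at hT
  rw [mul_div_assoc, ← hT, ← tsum_mul_right]
  calc ∑' N : ℕ, baileyWeight q N * qConv (q ^ 2) 2 (pentTerm q) N N
      = ∑' N : ℕ, ∑' j : ℤ, pentTerm q j * (baileyWeight q N *
          (qRecip (q ^ 2) (N + 2 * j) * qRecip (q ^ 2) (N - 2 * j))) := by
        refine tsum_congr fun N => ?_
        rw [qConv, ← tsum_mul_left]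
        exact tsum_congr fun j => by ring
    _ = ∑' j : ℤ, ∑' N : ℕ, pentTerm q j * (baileyWeight q N *
          (qRecip (q ^ 2) (N + 2 * j) * qRecip (q ^ 2) (N - 2 * j))) := by
        have := hs.tsum_comm (f := fun (N : ℕ) (j : ℤ) => pentTerm q j * (baileyWeight q N *
          (qRecip (q ^ 2) (N + 2 * j) * qRecip (q ^ 2) (N - 2 * j))))
        exact this.symm
    _ = _ := by
        refine tsum_congr fun j => ?_
        rw [tsum_mul_left]
        change pentTerm q j * baileySum q (2 * j) = _
        rw [baileySum_eq hq hq0, ← mul_assoc, pentTerm_mul_zpow_sq hq0]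

theorem summable_doubleSeries {q : ℂ} (hq : ‖q‖ < 1) :
    Summable fun p : ℕ × ℕ =>
      q ^ (p.1 ^ 2 + 3 * p.2 ^ 2 + 4 * p.1 * p.2) *
          qPoch (-q) (q ^ 2) (p.1 + p.2) * qPoch (q ^ 2) (q ^ 2) (p.1 + p.2) /
        (qPoch (q ^ 2) (q ^ 2) (2 * p.1 + 2 * p.2) * qPoch (q ^ 2) (q ^ 2) p.2 *
          qPoch (q ^ 2) (q ^ 2) p.1) := by
  have hQ := norm_sq_lt_one hq
  obtain ⟨A, hA⟩ := exists_norm_le_of_tendsto (tendsto_qPoch (-q) hQ)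
  obtain ⟨B, hB⟩ := exists_norm_le_of_tendsto (tendsto_qPoch (q ^ 2) hQ)
  obtain ⟨D, hD0, hD⟩ := exists_norm_qRecip_le hQ
  have hD' : ∀ k : ℕ, ‖qPoch (q ^ 2) (q ^ 2) k‖⁻¹ ≤ D := fun k => by
    simpa [qRecip_natCast] using hD k
  have hA0 : 0 ≤ A := (norm_nonneg _).trans (hA 0)
  have hB0 : 0 ≤ B := (norm_nonneg _).trans (hB 0)
  have hg := summable_geometric_of_lt_one (norm_nonneg q) hq
  refine Summable.of_norm_bounded (((hg.mul_of_nonneg hg (fun _ => by positivity)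
    (fun _ => by positivity))).mul_right (A * B * (D * D * D))) fun p => ?_
  have hp : ‖q‖ ^ (p.1 ^ 2 + 3 * p.2 ^ 2 + 4 * p.1 * p.2) ≤ ‖q‖ ^ p.1 * ‖q‖ ^ p.2 := by
    rw [← pow_add]
    refine pow_le_pow_of_le_one (norm_nonneg _) hq.le ?_
    nlinarith [Nat.le_self_pow two_ne_zero p.1, Nat.le_self_pow two_ne_zero p.2]
  rw [div_eq_mul_inv, norm_mul, norm_mul, norm_mul, norm_inv, norm_mul, norm_mul, norm_pow,
    mul_inv, mul_inv, mul_assoc (_ ^ _), mul_assoc (_ ^ _)]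
  gcongr
  · exact hA _
  · exact hB _
  · exact hD' _
  · exact hD' _
  · exact hD' _

theorem tsum_doubleSeries {q : ℂ} (hq : ‖q‖ < 1) (hq0 : q ≠ 0) :
    ∑' p : ℕ × ℕ,
      q ^ (p.1 ^ 2 + 3 * p.2 ^ 2 + 4 * p.1 * p.2) *
          qPoch (-q) (q ^ 2) (p.1 + p.2) * qPoch (q ^ 2) (q ^ 2) (p.1 + p.2) /
        (qPoch (q ^ 2) (q ^ 2) (2 * p.1 + 2 * p.2) * qPoch (q ^ 2) (q ^ 2) p.2 *
          qPoch (q ^ 2) (q ^ 2) p.1) =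
      qPochInf₃ (q ^ 6) (q ^ 8) (q ^ 14) (q ^ 14) * qPochInf (-q) (q ^ 2) /
        qPochInf (q ^ 2) (q ^ 2) := by
  have hQ := norm_sq_lt_one hq
  have hs := summable_doubleSeries hq
  rw [← tsum_baileyWeight_mul_qConv hq hq0]
  -- Regroup the double series along the antidiagonals n + r = N.
  refine (Finset.HasAntidiagonal.sigmaAntidiagonalEquivProd.tsum_eq _).symm.trans
    (((Finset.HasAntidiagonal.sigmaAntidiagonalEquivProd.summable_iff).mpr hs).tsum_sigma.trans ?_)
  refine tsum_congr fun N => ?_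
  rw [tsum_fintype]
  have h2 := qPoch_self_ne_zero hQ (2 * N)
  have h1 : qConv (q ^ 2) 2 (pentTerm q) N N =
      qPoch (q ^ 2) (q ^ 2) N / qPoch (q ^ 2) (q ^ 2) (2 * N) *
        qConv (q ^ 2) 1 (fun j => (q ^ 2) ^ (j * N)) 0 N := by
    have := (qPoch_mul_qConv_pent hq hq0 N).1
    field_simp
    linear_combination this
  rw [h1, qConv_one_eq_sum_antidiagonal, Finset.mul_sum, Finset.mul_sum,
    ← Finset.sum_coe_sort (antidiagonal N)]
  refine Finset.sum_congr rfl fun p _ => ?_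
  obtain ⟨⟨n, r⟩, hp⟩ := p
  obtain rfl : n + r = N := by simpa using hp
  simp only [Function.comp_apply, Finset.HasAntidiagonal.sigmaAntidiagonalEquivProd_apply,
    qRecip_natCast, baileyWeight]
  have e : q ^ (n ^ 2 + 3 * r ^ 2 + 4 * n * r) = q ^ (n + r) ^ 2 * (q ^ 2) ^ (r * (n + r)) := by
    rw [← pow_mul, ← pow_add]
    congr 1
    ring
  have e' : (q ^ 2) ^ ((r : ℤ) * ((n + r : ℕ) : ℤ)) = (q ^ 2) ^ (r * (n + r)) := by
    rw [← zpow_natCast (q ^ 2)]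
    push_cast
    rfl
  rw [e, e', mul_add, div_eq_mul_inv, div_eq_mul_inv, mul_inv, mul_inv]
  ring_nf

/-! ### Equivalent forms and conclusion -/

/-- Separates even and odd powers of -q. -/
theorem qPoch_neg_neg_two_mul (q : ℂ) (N : ℕ) :
    qPoch (-q) (-q) (2 * N) = qPoch (-q) (q ^ 2) N * qPoch (q ^ 2) (q ^ 2) N := by
  induction N with
  | zero => simp [qPoch_zero]
  | succ N ih =>
    rw [mul_add, mul_one, qPoch_succ, qPoch_succ, ih,
      qPoch_succ, qPoch_succ, pow_succ (-q) (2 * N), pow_mul (-q), neg_sq]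
    ring

/-- Splitting by parity gives (q;q)_{2N} = (q;q²)_N (q²;q²)_N, and (q;q²)_N (-q;q²)_N = (q²;q⁴)_N.
-/
theorem qPoch_self_two_mul (q : ℂ) (N : ℕ) :
    qPoch q q (2 * N) * qPoch (-q) (q ^ 2) N =
      qPoch (q ^ 2) (q ^ 4) N * qPoch (q ^ 2) (q ^ 2) N := by
  induction N with
  | zero => simp [qPoch_zero]
  | succ N ih =>
    rw [mul_add, mul_one, qPoch_succ, qPoch_succ, qPoch_succ, qPoch_succ, qPoch_succ]
    rw [← pow_mul, ← pow_mul]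
    linear_combination (1 - q * q ^ (2 * N)) * (1 - q * q ^ (2 * N + 1)) *
      (1 - -q * q ^ (2 * N)) * ih

theorem qPochInf_self_mul {q : ℂ} (hq : ‖q‖ < 1) :
    qPochInf q q * qPochInf (-q) (q ^ 2) = qPochInf (q ^ 2) (q ^ 4) * qPochInf (q ^ 2) (q ^ 2) := by
  have hQ := norm_sq_lt_one hq
  have h4 : ‖q ^ 4‖ < 1 := by
    rw [norm_pow]; exact pow_lt_one₀ (norm_nonneg _) hq (by norm_num)
  have h1 := ((tendsto_qPoch q hq).comp (tendsto_id.const_mul_atTop' two_pos)).mul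
    (tendsto_qPoch (-q) hQ)
  refine tendsto_nhds_unique (h1.congr fun N => ?_)
    ((tendsto_qPoch (q ^ 2) h4).mul (tendsto_qPoch (q ^ 2) hQ))
  simpa using qPoch_self_two_mul q N

theorem qPochInf_zero_left (q : ℂ) : qPochInf 0 q = 1 := by simp [qPochInf]

theorem hasSum_doubleSeries {q : ℂ} (hq : ‖q‖ < 1) :
    HasSum
      (fun p : ℕ × ℕ =>
        q ^ (p.1 ^ 2 + 3 * p.2 ^ 2 + 4 * p.1 * p.2) *
            qPoch (-q) (q ^ 2) (p.1 + p.2) * qPoch (q ^ 2) (q ^ 2) (p.1 + p.2) /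
          (qPoch (q ^ 2) (q ^ 2) (2 * p.1 + 2 * p.2) * qPoch (q ^ 2) (q ^ 2) p.2 *
            qPoch (q ^ 2) (q ^ 2) p.1))
      (qPochInf₃ (q ^ 6) (q ^ 8) (q ^ 14) (q ^ 14) * qPochInf (-q) (q ^ 2) /
        qPochInf (q ^ 2) (q ^ 2)) := by
  rcases eq_or_ne q 0 with rfl | hq0
  -- At q = 0 only the term n = r = 0 survives, with 0^0 = 1, and every infinite product equals 1.
  · have h := hasSum_ite_eq ((0, 0) : ℕ × ℕ) (1 : ℂ)
    convert h using 1
    · funext p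
      obtain ⟨n, r⟩ := p
      by_cases hp : n = 0 ∧ r = 0
      · obtain ⟨rfl, rfl⟩ := hp
        simp [qPoch_zero]
      · have h1 : n ^ 2 + 3 * r ^ 2 + 4 * n * r ≠ 0 := by
          rintro h0
          apply hp
          constructor <;> nlinarith
        simp [hp, zero_pow h1]
    · simp [qPochInf₃, qPochInf_zero_left]
  · rw [← tsum_doubleSeries hq hq0]
    exact (summable_doubleSeries hq).hasSum

/-- For complex `q` with `‖q‖ < 1`, the double series converges absolutely (in each of its two
equivalent forms) to the infinite product, which is given in its two equivalent forms. -/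
theorem mainTheorem2 (q : ℂ) (hq : ‖q‖ < 1) :
    HasSum
      (fun p : ℕ × ℕ =>
        q ^ (p.1 ^ 2 + 3 * p.2 ^ 2 + 4 * p.1 * p.2) *
            qPoch (-q) (q ^ 2) (p.1 + p.2) * qPoch (q ^ 2) (q ^ 2) (p.1 + p.2) /
          (qPoch (q ^ 2) (q ^ 2) (2 * p.1 + 2 * p.2) * qPoch (q ^ 2) (q ^ 2) p.2 *
            qPoch (q ^ 2) (q ^ 2) p.1))
      (qPochInf₃ (q ^ 6) (q ^ 8) (q ^ 14) (q ^ 14) * qPochInf (q ^ 2) (q ^ 4) / qPochInf q q) ∧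
    HasSum
      (fun p : ℕ × ℕ =>
        q ^ (p.1 ^ 2 + 3 * p.2 ^ 2 + 4 * p.1 * p.2) * qPoch (-q) (-q) (2 * p.1 + 2 * p.2) /
          (qPoch (q ^ 2) (q ^ 2) (2 * p.1 + 2 * p.2) * qPoch (q ^ 2) (q ^ 2) p.2 *
            qPoch (q ^ 2) (q ^ 2) p.1))
      (qPochInf₃ (q ^ 6) (q ^ 8) (q ^ 14) (q ^ 14) * qPochInf (q ^ 2) (q ^ 4) / qPochInf q q) ∧
    qPochInf₃ (q ^ 6) (q ^ 8) (q ^ 14) (q ^ 14) * qPochInf (q ^ 2) (q ^ 4) / qPochInf q q =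
      qPochInf₃ (q ^ 6) (q ^ 8) (q ^ 14) (q ^ 14) * qPochInf (-q) (q ^ 2) /
        qPochInf (q ^ 2) (q ^ 2) := by
  have hprod : qPochInf₃ (q ^ 6) (q ^ 8) (q ^ 14) (q ^ 14) * qPochInf (q ^ 2) (q ^ 4) /
      qPochInf q q =
      qPochInf₃ (q ^ 6) (q ^ 8) (q ^ 14) (q ^ 14) * qPochInf (-q) (q ^ 2) /
        qPochInf (q ^ 2) (q ^ 2) := by
    rw [div_eq_div_iff (qPochInf_self_ne_zero hq) (qPochInf_self_ne_zero (norm_sq_lt_one hq))]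
    linear_combination (-qPochInf₃ (q ^ 6) (q ^ 8) (q ^ 14) (q ^ 14)) * qPochInf_self_mul hq
  have h := hasSum_doubleSeries hq
  rw [← hprod] at h
  refine ⟨h, ?_, hprod⟩
  convert h using 3 with p
  rw [← mul_add, qPoch_neg_neg_two_mul, ← mul_assoc (q ^ _)]
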